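/- **Setting.** Let $N\ge 2$, $\alpha\ge 0$ and $r=(r_1,r_2)\in[0,1]^2$; write $(a)^+=\max(a,0)$. In the two-user fading interference channel at signal-to-noise ratio $\rho$, receiver $i$ observes $y_i=\sqrt{\rho}\,h_{ii}x_i+\sqrt{\rho^{\alpha}}\,h_{ji}x_j+z_i\in\mathbb C^N$ ($j\ne i$), with independent $h_{ii},h_{ji}\sim\mathcal{CN}(0,1)$ (known to receiver $i$ only) and $z_i\sim\mathcal{CN}(0,I_N)$. User $i$ sends $x_i=u_i+w_i$, with private $u_i\in\mathcal C^{u_i}(\rho)$ and public $w_i\in\mathcal C^{w_i}(\rho)$ uniform on finite codebooks in $\mathbb C^N$ and all messages independent. Receiver $i$ decodes $(u_i,w_i,w_j)$ jointly by maximum likelihood, $u_j$ being treated as noise (uniform on its codebook). $P(E_{ii})$ is the probability, over messages, fading and noise, that $(u_i,w_i)$ is decoded incorrectly (ties count as errors), and $P(E)=\max\{P(E_{11}),P(E_{22})\}$. A codebook sequence has multiplexing rate $a$ if its codebooks are non-empty and $\log|\mathcal C(\rho)|/\log\rho\to Na$ as $\rho\to\infty$. Write $f\,\dot\le\,\rho^{c}$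 if for every $\delta>0$, $f(\rho)\le\rho^{c+\delta}$ for all large $\rho$, and define $\dot\ge$ analogously; for codeword differences $\dot\ge$ is meant uniformly over all the pairs considered. **Exponents.** Let $d_{MU}^i(r)=(1-r_i)^+$ for $i=1,2$, $d_{MU}^3(r)=(1-r_1-r_2)^++(\alpha-r_1-r_2)^+$, and $d_{MU}=\min_{i=1,2,3} d_{MU}^i$. For $s,p\in\mathbb R^2$ and $i\neq j$ put $\nu_j=(\alpha-1+p_j)^+$ and $$d_{i1}=(p_i-s_i-\nu_j)^+,\quad d_{i2}=(1-r_i+s_i-\nu_j)^+,\quad d_{i3}=(1-r_i-\nu_j)^+,$$ and, for $m=4,5,6$, $$d_{im}=\begin{cases}(c_m-q_m)^++(\alpha-q_m)^+,& p_j<1-q_m,\\ (c_m-q_m-\nu_j)^+,& p_j\ge 1-q_m,\end{cases}$$ where $c_4=p_i$, $c_5=c_6=1$, $q_4=s_i+r_j-s_j$, $q_5=r_1+r_2-s_1-s_2$, $q_6=r_i+r_j-s_j$. Let $d(r,s,p)=\min_{k=1,2;\,l=1,\dots,6}d_{kl}(r,s,p)$. Call $(s,t,p)$ admissible if $s_i+t_i=r_i$,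 $s_i,t_i\ge0$, $0\le p_i<1$ for $i=1,2$; let $d_{HK}(r)=\sup d(r,s,p)$ over admissible $(s,t,p)$, and $d(r)=\max\{d_{HK}(r),d_{MU}(r)\}$. For vectors $a,b\in\mathbb C^N$ let $\lambda(a,b)$ be the smallest eigenvalue of the Gram matrix $[a\ b]^H[a\ b]$. Every $\epsilon\ge0$ below may be different, but does not depend on $\rho$. **Theorem.** (1) Suppose $d_{HK}(r)\le d_{MU}(r)$. Let $j^*\in\arg\min_i d_{MU}^i(r)$ and let $\Gamma_i=(\gamma_i^1,\gamma_i^2)\in\mathbb R^2$, $i=1,2,3$, satisfy $d_{MU}^i(\Gamma_i)=d_{MU}^{j^*}(r)$. Let only public messages be used ($u_i=0$, $x_i=w_i$), with codebook sequences $\mathcal C^{x_i}$ of multiplexing rates $r_i$ and $\|x_i\|^2\le N$ for all codewords and all $\rho>1$. If for some $\epsilon\ge0$ $$\|\Delta x_i\|^2\ \dot\ge\ \rho^{-\gamma_i^i+\epsilon}\ (i=1,2),\qquad \lambda(\Delta x_1,\Delta x_2)\ \dot\ge\ \rho^{-\gamma_3^1-\gamma_3^2+\epsilon}$$ for all differences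 $\Delta x_i$ of distinct codewords of $\mathcal C^{x_i}(\rho)$, then the DMT $d(r)$ is achieved: $P(E)\,\dot\le\,\rho^{-d(r)}$. (2) Suppose $d_{HK}(r)>d_{MU}(r)$. Let $(s,t,p)$ be admissible, let $(k^*,l^*)$ minimize $d_{kl}(r,s,p)$, and let $\Upsilon_{nm},\Psi_{nm}\in\mathbb R^2$ (components $\upsilon_{nm}^k,\psi_{nm}^k$) satisfy $d_{nm}(\Upsilon_{nm},\Psi_{nm},p)\ge d_{k^*l^*}(r,s,p)$ for $n=1,2$, $m=1,\dots,6$ (in particular, equality is allowed). Let $\mathcal C^{u_i},\mathcal C^{w_i}$ be codebook sequences of multiplexing rates $s_i,t_i$ with $\|u_i\|\le\sqrt{N/\rho^{1-p_i}}$ and $\|w_i\|\le\sqrt N\,(1-\sqrt{1/\rho^{1-p_i}})$ for all codewords and all $\rho>1$. Let $\Delta u_i=\sqrt{\rho^{1-p_i}}(\tilde u_i-\hat u_i)$ and $\Delta w_i=\tilde w_i-\hat w_i$ run over pairs of distinct codewords, and $\Delta x_i=(\tilde u_i+\tilde w_i)-(\hat u_i+\hat w_i)$ over pairs with $\tilde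 u_i\ne\hat u_i$ and $\tilde w_i\neq\hat w_i$. If for some $\epsilon\ge0$ and for all $i,j\in\{1,2\}$, $i\ne j$, $$\begin{aligned} \|\Delta u_i\|^2&\ \dot\ge\ \rho^{-\psi_{i1}^i+\epsilon}, & \lambda(\Delta u_i,\Delta w_j)&\ \dot\ge\ \rho^{-\psi_{i4}^i-\upsilon_{i4}^j+\psi_{i4}^j+\epsilon},\\ \|\Delta w_i\|^2&\ \dot\ge\ \rho^{-\upsilon_{i2}^i+\psi_{i2}^i+\epsilon}, & \lambda(\Delta w_i,\Delta w_j)&\ \dot\ge\ \rho^{-\upsilon_{i5}^1-\upsilon_{i5}^2+\psi_{i5}^1+\psi_{i5}^2+\epsilon},\\ \|\Delta x_i\|^2&\ \dot\ge\ \rho^{-\upsilon_{i3}^i+\epsilon}, & \lambda(\Delta x_i,\Delta w_j)&\ \dot\ge\ \rho^{-\upsilon_{i6}^i-\upsilon_{i6}^j+\psi_{i6}^j+\epsilon}, \end{aligned}$$ then $P(E)\,\dot\le\,\rho^{-d(r,s,p)}$. In particular, if $(s,t,p)=(s^*,t^*,p^*)$ attains the supremum $d_{HK}(r)$, then the DMT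 $d(r)$ is achieved: $P(E)\,\dot\le\,\rho^{-d(r)}$. -/

import Mathlib

open MeasureTheory Filter Topology

noncomputable section

namespace FadingIC

/-! ### SNR exponents -/

/-- `f ≤̇ ρ ^ c`: for every `δ > 0`, `f ρ ≤ ρ ^ (c + δ)` for all large `ρ`.
(This form also makes sense where `f` vanishes.) -/
def ExpLE (f : ℝ → ℝ) (c : ℝ) : Prop :=
  ∀ δ : ℝ, 0 < δ → ∀ᶠ ρ in atTop, f ρ ≤ ρ ^ (c + δ)

/-- `v ≥̇ ρ ^ c` for the values `v ∈ S ρ`, uniformly over the set `S ρ`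
(equivalently, for the smallest element when `S ρ` is finite and non-empty). -/
def ExpGE (S : ℝ → Set ℝ) (c : ℝ) : Prop :=
  ∀ δ : ℝ, 0 < δ → ∀ᶠ ρ in atTop, ∀ v ∈ S ρ, ρ ^ (c - δ) ≤ v

/-! ### The exponents of the multiuser (public messages only) scheme -/

/-- The three exponents of the scheme that uses public messages only. -/
def dMUi (α : ℝ) (i : Fin 3) (r : Fin 2 → ℝ) : ℝ :=
  ![max (1 - r 0) 0,
    max (1 - r 1) 0,
    max (1 - r 0 - r 1) 0 + max (α - r 0 - r 1) 0] i

def dMU (α : ℝ) (r : Fin 2 → ℝ) : ℝ := ⨅ i : Fin 3, dMUi α i r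

/-! ### The exponents of the superposition scheme

Below, `i` is the receiver, `j = other i`, `r` the multiplexing rates, `s` the private rates,
`p` the power exponents of the private messages. -/

/-- The other user. -/
def other (i : Fin 2) : Fin 2 := Fin.rev i

def d1 (α : ℝ) (i : Fin 2) (_r s p : Fin 2 → ℝ) : ℝ :=
  if p (other i) < 1 - α then max (p i - s i) 0
  else max (1 - α - p (other i) + p i - s i) 0

def d2 (α : ℝ) (i : Fin 2) (r s p : Fin 2 → ℝ) : ℝ :=
  if p (other i) < 1 - α then max (1 - r i + s i) 0
  else max (2 - α - p (other i) - r i + s i) 0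

def d3 (α : ℝ) (i : Fin 2) (r _s p : Fin 2 → ℝ) : ℝ :=
  if p (other i) < 1 - α then max (1 - r i) 0
  else max (2 - α - p (other i) - r i) 0

def d4 (α : ℝ) (i : Fin 2) (r s p : Fin 2 → ℝ) : ℝ :=
  if p (other i) < 1 - s i - r (other i) + s (other i) then
    max (p i - s i - r (other i) + s (other i)) 0 + max (α - s i - r (other i) + s (other i)) 0
  else if p (other i) < 1 - α then
    max (p i - s i - r (other i) + s (other i)) 0
  else
    max (1 - α - p (other i) + p i - s i - r (other i) + s (other i)) 0

def d5 (α : ℝ) (i : Fin 2) (r s p : Fin 2 → ℝ) : ℝ :=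
  if p (other i) < 1 - (∑ k, r k) + ∑ l, s l then
    max (1 - (∑ k, r k) + ∑ l, s l) 0 + max (α - (∑ k, r k) + ∑ l, s l) 0
  else if p (other i) < 1 - α then
    max (1 - (∑ k, r k) + ∑ l, s l) 0
  else
    max (2 - α - p (other i) - (∑ k, r k) + ∑ l, s l) 0

def d6 (α : ℝ) (i : Fin 2) (r s p : Fin 2 → ℝ) : ℝ :=
  if p (other i) < 1 - r i - r (other i) + s (other i) then
    max (1 - r i - r (other i) + s (other i)) 0 + max (α - r i - r (other i) + s (other i)) 0
  else if p (other i) < 1 - α then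
    max (1 - r i - r (other i) + s (other i)) 0
  else
    max (2 - α - p (other i) - r i - r (other i) + s (other i)) 0

/-- The twelve exponents `d_{kl}`; `l : Fin 6` stands for `l = 1, …, 6`. -/
def dkl (α : ℝ) (k : Fin 2) (l : Fin 6) (r s p : Fin 2 → ℝ) : ℝ :=
  ![d1 α k r s p, d2 α k r s p, d3 α k r s p, d4 α k r s p, d5 α k r s p, d6 α k r s p] l

/-- `d(r, s, p)`, the smallest of the `d_{kl}(r, s, p)`. -/
def dSplit (α : ℝ) (r s p : Fin 2 → ℝ) : ℝ := ⨅ kl : Fin 2 × Fin 6, dkl α kl.1 kl.2 r s p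

/-- Admissible private rates `s`, public rates `t` and power exponents `p`. -/
def Feasible (r s t p : Fin 2 → ℝ) : Prop :=
  ∀ i, s i + t i = r i ∧ 0 ≤ s i ∧ 0 ≤ t i ∧ 0 ≤ p i ∧ p i < 1

/-- `d_HK(r)`, the optimum of `d(r, s, p)` over all admissible `s`, `t`, `p`. -/
def dHK (α : ℝ) (r : Fin 2 → ℝ) : ℝ :=
  sSup {d | ∃ s t p, Feasible r s t p ∧ d = dSplit α r s p}

/-- `(s, t, p)` solves the optimization problem that defines `d_HK(r)`. -/
def IsOptimalSplit (α : ℝ) (r s t p : Fin 2 → ℝ) : Prop :=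
  Feasible r s t p ∧ ∀ s' t' p', Feasible r s' t' p' → dSplit α r s' p' ≤ dSplit α r s p

/-- The DMT of the fixed-power-split scheme. -/
def dmt (α : ℝ) (r : Fin 2 → ℝ) : ℝ := max (dHK α r) (dMU α r)

/-! ### The channel and joint maximum-likelihood decoding -/

/-- Vectors in `ℂ^N` with the Euclidean norm. -/
abbrev V (N : ℕ) : Type := EuclideanSpace ℂ (Fin N)

/-- The law `CN(0, 1)`, with density `π⁻¹ exp (-|z|²)` on `ℂ`. -/
def cn : Measure ℂ :=
  volume.withDensity fun z => ENNReal.ofReal (Real.pi⁻¹ * Real.exp (-‖z‖ ^ 2))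

/-- The law `CN(0, I_N)` on `ℂ^N`: independent `CN(0, 1)` coordinates. -/
def cnVec (N : ℕ) : Measure (V N) :=
  (Measure.pi fun _ : Fin N => cn).map (WithLp.toLp 2)

/-- The noiseless received signal `√ρ h_{ii} x_i + √(ρ^α) h_{ji} x_j`; here `h.1 = h_{ii}` and
`h.2 = h_{ji}`. -/
def signal {N : ℕ} (α ρ : ℝ) (h : ℂ × ℂ) (x x' : V N) : V N :=
  ((√ρ : ℂ) * h.1) • x + ((√(ρ ^ α) : ℂ) * h.2) • x'

/-- The likelihood (up to a constant factor) of the triple of own private message `u`, own public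
message `w` and interfering public message `v`, given the received vector `y` and the channel `h`.
The interfering private message, which is not decoded, is uniform on its codebook `Cuj`. -/
def likelihood {N : ℕ} (α ρ : ℝ) (Cuj : Finset (V N)) (h : ℂ × ℂ) (y u w v : V N) : ℝ :=
  ∑ u' ∈ Cuj, Real.exp (-‖y - signal α ρ h (u + w) (u' + v)‖ ^ 2)

/-- The joint maximum-likelihood decoder at receiver `i` fails to recover the own message
`(u, w)` from `y`: a triple with a wrong own message has a likelihood at least as large as every
triple with the correct own message. Ties count as errors; a wrong decision on the interfering
message alone is not an error. -/
def DecodingError {N : ℕ} (α ρ : ℝ) (Cu Cw : Fin 2 → Finset (V N)) (i : Fin 2)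
    (h : ℂ × ℂ) (y u w : V N) : Prop :=
  ∃ u₁ ∈ Cu i, ∃ w₁ ∈ Cw i, ∃ v₁ ∈ Cw (other i), (u₁, w₁) ≠ (u, w) ∧
    ∀ v ∈ Cw (other i),
      likelihood α ρ (Cu (other i)) h y u w v ≤ likelihood α ρ (Cu (other i)) h y u₁ w₁ v₁

/-- `P(E_ii)`: the error probability at receiver `i`, averaged over equally likely messages of
both users, over the independent `CN(0, 1)` fading coefficients and over the noise. -/
def rxErrorProb {N : ℕ} (α ρ : ℝ) (Cu Cw : Fin 2 → Finset (V N)) (i : Fin 2) : ℝ :=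
  (((Cu i).card : ℝ) * (Cw i).card * (Cu (other i)).card * (Cw (other i)).card)⁻¹ *
    ∑ u ∈ Cu i, ∑ w ∈ Cw i, ∑ u' ∈ Cu (other i), ∑ v ∈ Cw (other i),
      ((cn.prod cn).prod (cnVec N)).real
        {ω | DecodingError α ρ Cu Cw i ω.1 (signal α ρ ω.1 (u + w) (u' + v) + ω.2) u w}

/-- `P(E) = max {P(E_11), P(E_22)}`. -/
def errorProb {N : ℕ} (α ρ : ℝ) (Cu Cw : Fin 2 → Finset (V N)) : ℝ :=
  max (rxErrorProb α ρ Cu Cw 0) (rxErrorProb α ρ Cu Cw 1)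

/-! ### Codebook sequences and their differences -/

/-- A sequence (in the SNR `ρ`) of codebooks in `ℂ^N` of multiplexing rate `r`:
`|C ρ| ≐ ρ ^ (N r)`. -/
structure IsCodebookSeq {N : ℕ} (r : ℝ) (C : ℝ → Finset (V N)) : Prop where
  nonempty : ∀ ρ, (C ρ).Nonempty
  rate : Tendsto (fun ρ => Real.log (C ρ).card / Real.log ρ) atTop (𝓝 (N * r))

/-- Differences of distinct codewords. -/
def diffs {N : ℕ} (C : ℝ → Finset (V N)) (ρ : ℝ) : Set (V N) :=
  {d | ∃ a ∈ C ρ, ∃ b ∈ C ρ, a ≠ b ∧ d = a - b}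

/-- Differences of distinct private codewords, rescaled by `√(ρ^(1-p))`. -/
def privateDiffs {N : ℕ} (p : ℝ) (C : ℝ → Finset (V N)) (ρ : ℝ) : Set (V N) :=
  {d | ∃ a ∈ C ρ, ∃ b ∈ C ρ, a ≠ b ∧ d = (√(ρ ^ (1 - p)) : ℂ) • (a - b)}

/-- Differences of superposition codewords `u + w` whose private and public parts both differ. -/
def combinedDiffs {N : ℕ} (Cu Cw : ℝ → Finset (V N)) (ρ : ℝ) : Set (V N) :=
  {d | ∃ a ∈ Cu ρ, ∃ b ∈ Cu ρ, ∃ a' ∈ Cw ρ, ∃ b' ∈ Cw ρ,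
    a ≠ b ∧ a' ≠ b' ∧ d = (a + a') - (b + b')}

/-- The `N × 2` matrix with columns `a` and `b`. -/
def stack {N : ℕ} (a b : V N) : Matrix (Fin N) (Fin 2) ℂ := Matrix.of fun n k => ![a n, b n] k

/-- The smallest eigenvalue of the `2 × 2` Gram matrix `Xᴴ X`. -/
def gramMin {N : ℕ} (X : Matrix (Fin N) (Fin 2) ℂ) : ℝ :=
  ⨅ k : Fin 2, (Matrix.isHermitian_conjTranspose_mul_self X).eigenvalues k

/-- `‖d‖² ≥̇ ρ ^ (c + ε)` for all `d ∈ D ρ`, for some `ε ≥ 0`. -/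
def NormCriterion {N : ℕ} (D : ℝ → Set (V N)) (c : ℝ) : Prop :=
  ∃ ε : ℝ, 0 ≤ ε ∧ ExpGE (fun ρ => {v | ∃ d ∈ D ρ, v = ‖d‖ ^ 2}) (c + ε)

/-- The smallest eigenvalue of the Gram matrix of `[d d']` is `≥̇ ρ ^ (c + ε)` for all `d ∈ D ρ`,
`d' ∈ D' ρ`, for some `ε ≥ 0`. -/
def GramCriterion {N : ℕ} (D D' : ℝ → Set (V N)) (c : ℝ) : Prop :=
  ∃ ε : ℝ, 0 ≤ ε ∧
    ExpGE (fun ρ => {v | ∃ d ∈ D ρ, ∃ d' ∈ D' ρ, v = gramMin (stack d d')}) (c + ε)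

/-- The criteria of multiple-access type; `Γ i` is the rate pair attached to the `i`-th exponent
(`Γ 0`, `Γ 1` for the two single-user exponents, `Γ 2` for the joint one). -/
structure MACCriteria {N : ℕ} (Γ : Fin 3 → Fin 2 → ℝ) (C : Fin 2 → ℝ → Finset (V N)) :
    Prop where
  user1 : NormCriterion (diffs (C 0)) (-Γ 0 0)
  user2 : NormCriterion (diffs (C 1)) (-Γ 1 1)
  joint : GramCriterion (diffs (C 0)) (diffs (C 1)) (-Γ 2 0 - Γ 2 1)

/-- The criteria for superposition codes; `Υ n m` and `Ψ n m` are the total-rate and private-rate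
pairs attached to the exponent `d_{n,m+1}`. -/
structure SuperpositionCriteria {N : ℕ} (p : Fin 2 → ℝ) (Υ Ψ : Fin 2 → Fin 6 → Fin 2 → ℝ)
    (Cu Cw : Fin 2 → ℝ → Finset (V N)) : Prop where
  priv : ∀ i, NormCriterion (privateDiffs (p i) (Cu i)) (-Ψ i 0 i)
  pub : ∀ i, NormCriterion (diffs (Cw i)) (-Υ i 1 i + Ψ i 1 i)
  combined : ∀ i, NormCriterion (combinedDiffs (Cu i) (Cw i)) (-Υ i 2 i)
  privPub : ∀ i, GramCriterion (privateDiffs (p i) (Cu i)) (diffs (Cw (other i)))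
    (-Ψ i 3 i - Υ i 3 (other i) + Ψ i 3 (other i))
  pubPub : ∀ i, GramCriterion (diffs (Cw i)) (diffs (Cw (other i)))
    (-(∑ k, Υ i 4 k) + ∑ k, Ψ i 4 k)
  combinedPub : ∀ i, GramCriterion (combinedDiffs (Cu i) (Cw i)) (diffs (Cw (other i)))
    (-Υ i 5 i - Υ i 5 (other i) + Ψ i 5 (other i))

/-- The power constraints of the fixed power split with private power exponents `p`. -/
def PowerSplit {N : ℕ} (p : Fin 2 → ℝ) (Cu Cw : Fin 2 → ℝ → Finset (V N)) : Prop :=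
  ∀ i, ∀ ρ : ℝ, 1 < ρ →
    (∀ u ∈ Cu i ρ, ‖u‖ ≤ √(N / ρ ^ (1 - p i))) ∧
    (∀ w ∈ Cw i ρ, ‖w‖ ≤ √N * (1 - √(1 / ρ ^ (1 - p i))))

end FadingIC

end

/-!
Nothing is lost by bounding every decoding error by a channel outage. If maximum likelihood prefers
a wrong triple, then for some interfering private codeword the residual is at most
`‖z‖² + log |C|`, and `log |C|` grows slower than every power of `ρ`. Outside an event of
super-polynomially small probability, the signal of the codeword differences is therefore not
stronger, up to a factor `ρ ^ δ`, than noise plus residual interference. As the criteria bound this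
signal from below uniformly over all pairs of codewords, one fading event covers all pairs, and no
union bound over codewords is needed. For an error in own messages only, this event is a deep fade
of the direct link. For a joint error, it forces a deep fade of both links if the interfering public
signal dominates the residual interference on the same cross link; otherwise only the fade of the
direct link remains. The resulting exponents are the `d_{kl}`.
-/

namespace FadingIC

/-! ### Gaussian laws -/

lemma lintegral_inv_pi_mul_exp_neg_mul_norm_sq {b : ℝ} (hb : 0 < b) :
    ∫⁻ z : ℂ, ENNReal.ofReal (Real.pi⁻¹ * Real.exp (-b * ‖z‖ ^ 2)) = ENNReal.ofReal b⁻¹ := by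
  have hint : ∫ z : ℂ, Real.exp (-b * ‖z‖ ^ 2) = Real.pi / b := by
    simpa using GaussianFourier.integral_rexp_neg_mul_sq_norm (V := ℂ) hb
  have hintegrable : Integrable fun z : ℂ => Real.exp (-b * ‖z‖ ^ 2) :=
    .of_integral_ne_zero (hint.trans_ne (by positivity))
  rw [← ofReal_integral_eq_lintegral_ofReal (hintegrable.const_mul _)
    (.of_forall fun z => by positivity), integral_const_mul, hint]
  field_simp

instance : IsProbabilityMeasure cn := by
  constructor
  simpa [cn] using lintegral_inv_pi_mul_exp_neg_mul_norm_sq one_pos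

instance (N : ℕ) : IsProbabilityMeasure (cnVec N) :=
  Measure.isProbabilityMeasure_map (by fun_prop)

lemma measurableSet_lt_norm_sq {E : Type*} [NormedAddCommGroup E] [MeasurableSpace E]
    [OpensMeasurableSpace E] (x : ℝ) : MeasurableSet {z : E | x < ‖z‖ ^ 2} :=
  measurableSet_lt measurable_const (measurable_norm.pow_const 2)

lemma cn_real_norm_sq_le {x : ℝ} (hx : 0 ≤ x) : cn.real {h | ‖h‖ ^ 2 ≤ x} ≤ x := by
  have hball : {h : ℂ | ‖h‖ ^ 2 ≤ x} = Metric.closedBall 0 (√x) := by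
    ext h
    simp [Real.le_sqrt (norm_nonneg h) hx]
  have hvol : ENNReal.ofReal Real.pi⁻¹ * volume (Metric.closedBall (0 : ℂ) (√x)) =
      ENNReal.ofReal x := by
    rw [Complex.volume_closedBall, ← ENNReal.ofReal_pow (by positivity), Real.sq_sqrt hx,
      ← ENNReal.ofReal_coe_nnreal, ← ENNReal.ofReal_mul hx, ← ENNReal.ofReal_mul (by positivity),
      NNReal.coe_real_pi]
    field_simp
  refine ENNReal.toReal_le_of_le_ofReal hx ?_
  rw [hball, cn, withDensity_apply _ Metric.isClosed_closedBall.measurableSet]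
  calc ∫⁻ z in Metric.closedBall (0 : ℂ) (√x), ENNReal.ofReal (Real.pi⁻¹ * Real.exp (-‖z‖ ^ 2))
      ≤ ∫⁻ _ in Metric.closedBall (0 : ℂ) (√x), ENNReal.ofReal Real.pi⁻¹ := by
        gcongr with z
        exact mul_le_of_le_one_right (by positivity) (Real.exp_le_one_iff.2 (by simp))
    _ = ENNReal.ofReal x := by rw [lintegral_const, Measure.restrict_apply_univ, hvol]

lemma cn_real_lt_norm_sq_le (x : ℝ) : cn.real {h | x < ‖h‖ ^ 2} ≤ 2 * Real.exp (-(x / 2)) := by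
  have hm : MeasurableSet {h : ℂ | x < ‖h‖ ^ 2} := measurableSet_lt_norm_sq x
  refine ENNReal.toReal_le_of_le_ofReal (by positivity) ?_
  rw [cn, withDensity_apply _ hm]
  calc ∫⁻ z in {h : ℂ | x < ‖h‖ ^ 2}, ENNReal.ofReal (Real.pi⁻¹ * Real.exp (-‖z‖ ^ 2))
      ≤ ∫⁻ z in {h : ℂ | x < ‖h‖ ^ 2}, ENNReal.ofReal (Real.exp (-(x / 2))) *
          ENNReal.ofReal (Real.pi⁻¹ * Real.exp (-(1 / 2) * ‖z‖ ^ 2)) := by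
        refine setLIntegral_mono' hm fun z hz => ?_
        rw [← ENNReal.ofReal_mul (by positivity), mul_left_comm, ← Real.exp_add]
        gcongr
        have : x < ‖z‖ ^ 2 := hz
        linarith
    _ ≤ ∫⁻ z, ENNReal.ofReal (Real.exp (-(x / 2))) *
          ENNReal.ofReal (Real.pi⁻¹ * Real.exp (-(1 / 2) * ‖z‖ ^ 2)) :=
        setLIntegral_le_lintegral _ _
    _ = ENNReal.ofReal (2 * Real.exp (-(x / 2))) := by
        rw [lintegral_const_mul' _ _ ENNReal.ofReal_ne_top,
          lintegral_inv_pi_mul_exp_neg_mul_norm_sq (by norm_num),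
          ← ENNReal.ofReal_mul (by positivity)]
        norm_num [mul_comm]

lemma cnVec_real_lt_norm_sq_le (N : ℕ) (x : ℝ) :
    (cnVec N).real {z | N * x < ‖z‖ ^ 2} ≤ N * (2 * Real.exp (-(x / 2))) := by
  have hcoord : WithLp.toLp 2 ⁻¹' {z : V N | N * x < ‖z‖ ^ 2} ⊆
      ⋃ k, Function.eval k ⁻¹' {h : ℂ | x < ‖h‖ ^ 2} := by
    intro z hz
    have hsum : ∑ _ : Fin N, x < ∑ k, ‖z k‖ ^ 2 := by
      simpa [EuclideanSpace.norm_sq_eq] using hz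
    obtain ⟨k, -, hk⟩ := Finset.exists_lt_of_sum_lt hsum
    exact Set.mem_iUnion.2 ⟨k, hk⟩
  rw [cnVec, map_measureReal_apply (by fun_prop) (measurableSet_lt_norm_sq _)]
  calc (Measure.pi fun _ => cn).real (WithLp.toLp 2 ⁻¹' {z : V N | N * x < ‖z‖ ^ 2})
      ≤ ∑ k : Fin N, (Measure.pi fun _ => cn).real (Function.eval k ⁻¹' {h : ℂ | x < ‖h‖ ^ 2}) :=
        (measureReal_mono hcoord).trans (measureReal_iUnion_fintype_le _)
    _ = ∑ _ : Fin N, cn.real {h | x < ‖h‖ ^ 2} := by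
        refine Finset.sum_congr rfl fun k _ => ?_
        exact (measurePreserving_eval (fun _ : Fin N => cn) k).measureReal_preimage
          (measurableSet_lt_norm_sq x).nullMeasurableSet
    _ ≤ N * (2 * Real.exp (-(x / 2))) := by
        simpa using mul_le_mul_of_nonneg_left (cn_real_lt_norm_sq_le x) N.cast_nonneg

/-! ### Outage exponents -/

/-- The events `S δ ρ` have probability `≤̇ ρ ^ (-d)` as `ρ → ∞`, up to a loss in the exponent that
vanishes with the slack `δ`. Subpolynomial factors in the description of an event are absorbed
into `ρ ^ δ`. -/
def HasOutageExponent {Ω : Type*} [MeasurableSpace Ω] (μ : Measure Ω) (S : ℝ → ℝ → Set Ω)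
    (d : ℝ) : Prop :=
  ∀ η : ℝ, 0 < η → ∀ᶠ δ in 𝓝[>] 0, ∀ᶠ ρ in atTop, μ.real (S δ ρ) ≤ ρ ^ (-d + η)

lemma eventually_le_rpow (K : ℝ) {a : ℝ} (ha : 0 < a) : ∀ᶠ ρ : ℝ in atTop, K ≤ ρ ^ a :=
  (tendsto_rpow_atTop ha).eventually_ge_atTop K

lemma eventually_mul_exp_neg_mul_rpow_le_rpow (K c : ℝ) {b a : ℝ} (hb : 0 < b) (ha : 0 < a) :
    ∀ᶠ ρ : ℝ in atTop, K * Real.exp (-b * ρ ^ a) ≤ ρ ^ c := by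
  have h := ((isLittleO_exp_neg_mul_rpow_atTop hb (c / a)).const_mul_left K).comp_tendsto
    (tendsto_rpow_atTop ha)
  filter_upwards [h.bound one_pos, eventually_gt_atTop 0] with ρ hbound hρ
  simp only [Function.comp, one_mul] at hbound
  rw [← Real.rpow_mul hρ.le, mul_div_cancel₀ _ ha.ne',
    Real.norm_of_nonneg (Real.rpow_nonneg hρ.le c)] at hbound
  exact (Real.le_norm_self _).trans hbound

namespace HasOutageExponent

variable {Ω Ω' : Type*} [MeasurableSpace Ω] [MeasurableSpace Ω'] {μ : Measure Ω} {ν : Measure Ω'}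
  {S T : ℝ → ℝ → Set Ω} {d d' : ℝ}

lemma mono [IsFiniteMeasure μ] (hT : HasOutageExponent μ T d)
    (h : ∀ᶠ δ in 𝓝[>] 0, ∀ᶠ ρ in atTop, S δ ρ ⊆ T δ ρ) : HasOutageExponent μ S d := by
  intro η hη
  filter_upwards [hT η hη, h] with δ hTδ hδ
  filter_upwards [hTδ, hδ] with ρ hTρ hρ
  exact (measureReal_mono hρ).trans hTρ

lemma of_le (hS : HasOutageExponent μ S d) (h : d' ≤ d) : HasOutageExponent μ S d' := by
  intro η hη
  filter_upwards [hS η hη] with δ hδ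
  filter_upwards [hδ, eventually_ge_atTop 1] with ρ hρ hρ1
  exact hρ.trans (Real.rpow_le_rpow_of_exponent_le hρ1 (by linarith))

lemma of_nonpos [IsProbabilityMeasure μ] (hd : d ≤ 0) : HasOutageExponent μ S d := by
  intro η hη
  filter_upwards with δ
  filter_upwards [eventually_ge_atTop 1] with ρ hρ
  exact measureReal_le_one.trans (Real.one_le_rpow hρ (by linarith))

lemma union (hS : HasOutageExponent μ S d) (hT : HasOutageExponent μ T d) :
    HasOutageExponent μ (fun δ ρ => S δ ρ ∪ T δ ρ) d := by
  intro η hη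
  filter_upwards [hS (η / 2) (half_pos hη), hT (η / 2) (half_pos hη)] with δ hSδ hTδ
  filter_upwards [hSδ, hTδ, eventually_gt_atTop 0, eventually_le_rpow 2 (half_pos hη)]
    with ρ hSρ hTρ hρ h2
  calc μ.real (S δ ρ ∪ T δ ρ) ≤ μ.real (S δ ρ) + μ.real (T δ ρ) := measureReal_union_le _ _
    _ ≤ 2 * ρ ^ (-d + η / 2) := by linarith
    _ ≤ ρ ^ (η / 2) * ρ ^ (-d + η / 2) := by gcongr
    _ = ρ ^ (-d + η) := by rw [← Real.rpow_add hρ]; ring_nf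

lemma prod [SFinite ν] {T : ℝ → ℝ → Set Ω'} (hS : HasOutageExponent μ S d)
    (hT : HasOutageExponent ν T d') :
    HasOutageExponent (μ.prod ν) (fun δ ρ => S δ ρ ×ˢ T δ ρ) (d + d') := by
  intro η hη
  filter_upwards [hS (η / 2) (half_pos hη), hT (η / 2) (half_pos hη)] with δ hSδ hTδ
  filter_upwards [hSδ, hTδ, eventually_gt_atTop 0] with ρ hSρ hTρ hρ
  calc (μ.prod ν).real (S δ ρ ×ˢ T δ ρ) = μ.real (S δ ρ) * ν.real (T δ ρ) :=
        measureReal_prod_prod _ _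
    _ ≤ ρ ^ (-d + η / 2) * ρ ^ (-d' + η / 2) := by gcongr
    _ = ρ ^ (-(d + d') + η) := by rw [← Real.rpow_add hρ]; ring_nf

lemma preimage_fst [IsProbabilityMeasure ν] (hS : HasOutageExponent μ S d) :
    HasOutageExponent (μ.prod ν) (fun δ ρ => Prod.fst ⁻¹' S δ ρ) d := by
  simpa [Set.prod_univ] using hS.prod (of_nonpos (μ := ν) (S := fun _ _ => Set.univ) le_rfl)

lemma preimage_snd [IsProbabilityMeasure μ] [SFinite ν] {T : ℝ → ℝ → Set Ω'}
    (hT : HasOutageExponent ν T d) :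
    HasOutageExponent (μ.prod ν) (fun δ ρ => Prod.snd ⁻¹' T δ ρ) d := by
  simpa [Set.univ_prod] using (of_nonpos (μ := μ) (S := fun _ _ => Set.univ) le_rfl).prod hT

end HasOutageExponent

lemma hasOutageExponent_cn_norm_sq_le_rpow (x k : ℝ) :
    HasOutageExponent cn (fun δ ρ => {h | ‖h‖ ^ 2 ≤ ρ ^ (-x + k * δ)}) (max x 0) := by
  rcases le_total x 0 with hx | hx
  · exact .of_nonpos (by simp [hx])
  intro η hη
  have hslack : Tendsto (fun δ => k * δ) (𝓝[>] 0) (𝓝 0) :=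
    ((continuous_const_mul k).tendsto' 0 0 (by simp)).mono_left nhdsWithin_le_nhds
  filter_upwards [hslack.eventually_lt_const hη] with δ hδ
  filter_upwards [eventually_ge_atTop 1] with ρ hρ
  calc cn.real {h | ‖h‖ ^ 2 ≤ ρ ^ (-x + k * δ)} ≤ ρ ^ (-x + k * δ) :=
        cn_real_norm_sq_le (by positivity)
    _ ≤ ρ ^ (-max x 0 + η) :=
        Real.rpow_le_rpow_of_exponent_le hρ (by rw [max_eq_left hx]; linarith)

lemma hasOutageExponent_cn_rpow_lt_norm_sq (d : ℝ) :
    HasOutageExponent cn (fun δ ρ => {h | ρ ^ δ < ‖h‖ ^ 2}) d := by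
  intro η _
  filter_upwards [self_mem_nhdsWithin] with δ hδ
  filter_upwards [eventually_mul_exp_neg_mul_rpow_le_rpow 2 (-d + η) one_half_pos hδ] with ρ hρ
  refine (cn_real_lt_norm_sq_le _).trans (le_of_eq_of_le ?_ hρ)
  ring_nf

lemma hasOutageExponent_cnVec_rpow_lt_norm_sq (N : ℕ) (d : ℝ) {k : ℝ} (hk : 0 < k) :
    HasOutageExponent (cnVec N) (fun δ ρ => {z | N * ρ ^ (k * δ) < ‖z‖ ^ 2}) d := by
  intro η _
  filter_upwards [self_mem_nhdsWithin] with δ hδ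
  filter_upwards [eventually_mul_exp_neg_mul_rpow_le_rpow (N * 2) (-d + η) one_half_pos
    (mul_pos hk hδ)] with ρ hρ
  refine (cnVec_real_lt_norm_sq_le N _).trans (le_of_eq_of_le ?_ hρ)
  ring_nf

/-! ### Deep fades -/

lemma le_rpow_sub_of_rpow_mul_le {ρ a b A : ℝ} (hρ : 0 < ρ) (h : ρ ^ a * A ≤ ρ ^ b) :
    A ≤ ρ ^ (b - a) := by
  rwa [Real.rpow_sub hρ, le_div_iff₀' (Real.rpow_pos_of_pos hρ a)]

lemma hasOutageExponent_direct_fade (x β : ℝ) :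
    HasOutageExponent (cn.prod cn)
      (fun δ ρ => {h | ρ ^ (x - δ) * ‖h.1‖ ^ 2 ≤ ρ ^ δ * (1 + ρ ^ β * ‖h.2‖ ^ 2)})
      (max (x - max β 0) 0) := by
  refine ((hasOutageExponent_cn_norm_sq_le_rpow (x - max β 0) 4).preimage_fst.union
    (hasOutageExponent_cn_rpow_lt_norm_sq _).preimage_snd).mono ?_
  filter_upwards [self_mem_nhdsWithin] with δ (hδ : 0 < δ)
  filter_upwards [eventually_ge_atTop 1, eventually_le_rpow 2 hδ] with ρ hρ h2 h hh
  have hρ0 : 0 < ρ := by linarith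
  refine or_iff_not_imp_right.2 fun hcross => ?_
  replace hcross : ‖h.2‖ ^ 2 ≤ ρ ^ δ := not_lt.1 hcross
  have hnoise : 1 ≤ ρ ^ (max β 0 + δ) := Real.one_le_rpow hρ (by positivity)
  have hinterference : ρ ^ β * ‖h.2‖ ^ 2 ≤ ρ ^ (max β 0 + δ) := by
    rw [Real.rpow_add hρ0]
    gcongr
    exact le_max_left _ _
  have hweak : ρ ^ (x - δ) * ‖h.1‖ ^ 2 ≤ ρ ^ (max β 0 + 3 * δ) :=
    calc ρ ^ (x - δ) * ‖h.1‖ ^ 2 ≤ ρ ^ δ * (1 + ρ ^ β * ‖h.2‖ ^ 2) := hh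
      _ ≤ ρ ^ δ * (2 * ρ ^ (max β 0 + δ)) := by gcongr; linarith
      _ ≤ ρ ^ δ * (ρ ^ δ * ρ ^ (max β 0 + δ)) := by gcongr
      _ = ρ ^ (max β 0 + 3 * δ) := by rw [← Real.rpow_add hρ0, ← Real.rpow_add hρ0]; ring_nf
  exact (le_rpow_sub_of_rpow_mul_le hρ0 hweak).trans_eq (by ring_nf)

lemma hasOutageExponent_double_fade (x : ℝ) {y β : ℝ} (hβ : β < y) :
    HasOutageExponent (cn.prod cn)
      (fun δ ρ => {h | ρ ^ (x - δ) * ‖h.1‖ ^ 2 + ρ ^ (y - δ) * ‖h.2‖ ^ 2 ≤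
        ρ ^ δ * (1 + ρ ^ β * ‖h.2‖ ^ 2)})
      (max x 0 + max y 0) := by
  refine ((hasOutageExponent_cn_norm_sq_le_rpow x 3).prod
    (hasOutageExponent_cn_norm_sq_le_rpow y 3)).mono ?_
  filter_upwards [Ioo_mem_nhdsGT (show 0 < (y - β) / 2 by linarith)] with δ ⟨hδ, hδβ⟩
  filter_upwards [eventually_gt_atTop 0, eventually_le_rpow 2 hδ,
    eventually_le_rpow 2 (show 0 < y - β - 2 * δ by linarith)] with ρ hρ h2 h2β h hh
  replace hh : ρ ^ (x - δ) * ‖h.1‖ ^ 2 + ρ ^ (y - δ) * ‖h.2‖ ^ 2 ≤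
      ρ ^ δ * (1 + ρ ^ β * ‖h.2‖ ^ 2) := hh
  have hinterference : 2 * (ρ ^ δ * (ρ ^ β * ‖h.2‖ ^ 2)) ≤ ρ ^ (y - δ) * ‖h.2‖ ^ 2 :=
    calc 2 * (ρ ^ δ * (ρ ^ β * ‖h.2‖ ^ 2))
        ≤ ρ ^ (y - β - 2 * δ) * (ρ ^ δ * (ρ ^ β * ‖h.2‖ ^ 2)) := by gcongr
      _ = ρ ^ (y - δ) * ‖h.2‖ ^ 2 := by
        rw [← mul_assoc, ← mul_assoc, ← Real.rpow_add hρ, ← Real.rpow_add hρ]; ring_nf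
  have hslack : 2 * ρ ^ δ ≤ ρ ^ (2 * δ) := by
    rw [two_mul δ, Real.rpow_add hρ]
    gcongr
  have hdirect0 : 0 ≤ ρ ^ (x - δ) * ‖h.1‖ ^ 2 := by positivity
  have hcross0 : 0 ≤ ρ ^ (y - δ) * ‖h.2‖ ^ 2 := by positivity
  have hdirect : ρ ^ (x - δ) * ‖h.1‖ ^ 2 ≤ ρ ^ (2 * δ) := by linarith
  have hcross : ρ ^ (y - δ) * ‖h.2‖ ^ 2 ≤ ρ ^ (2 * δ) := by linarith
  exact ⟨(le_rpow_sub_of_rpow_mul_le hρ hdirect).trans_eq (by ring_nf),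
    (le_rpow_sub_of_rpow_mul_le hρ hcross).trans_eq (by ring_nf)⟩

/-! ### Separation of codeword differences -/

open scoped MatrixOrder ComplexOrder Matrix in
lemma le_iInf_eigenvalues_iff {n : Type*} [Fintype n] [DecidableEq n] [Nonempty n]
    {A : Matrix n n ℂ} (hA : A.IsHermitian) {m : ℝ} :
    m ≤ ⨅ k, hA.eigenvalues k ↔ ∀ v : n → ℂ, (m : ℂ) * (star v ⬝ᵥ v) ≤ star v ⬝ᵥ (A *ᵥ v) := by
  have hscalar : (algebraMap ℝ (Matrix n n ℂ) m).IsHermitian :=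
    IsSelfAdjoint.algebraMap _ (.all m)
  calc m ≤ ⨅ k, hA.eigenvalues k ↔ ∀ x ∈ spectrum ℝ A, m ≤ x := by
        rw [le_ciInf_iff (Set.finite_range _).bddBelow, hA.spectrum_real_eq_range_eigenvalues,
          Set.forall_mem_range]
    _ ↔ (A - algebraMap ℝ _ m).PosSemidef := by
        rw [← Matrix.le_iff, algebraMap_le_iff_le_spectrum hA]
    _ ↔ ∀ v : n → ℂ, (m : ℂ) * (star v ⬝ᵥ v) ≤ star v ⬝ᵥ (A *ᵥ v) := by
        rw [Matrix.posSemidef_iff_dotProduct_mulVec, and_iff_right (hA.sub hscalar)]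
        refine forall_congr' fun v => ?_
        rw [Matrix.sub_mulVec, dotProduct_sub, sub_nonneg, Algebra.algebraMap_eq_smul_one,
          Matrix.smul_mulVec, Matrix.one_mulVec, dotProduct_smul, Complex.real_smul]

open scoped ComplexOrder Matrix in
lemma le_gramMin_stack_iff {N : ℕ} {a b : V N} {m : ℝ} :
    m ≤ gramMin (stack a b) ↔
      ∀ x y : ℂ, m * (‖x‖ ^ 2 + ‖y‖ ^ 2) ≤ ‖x • a + y • b‖ ^ 2 := by
  have hcomb (x y : ℂ) : stack a b *ᵥ ![x, y] = WithLp.ofLp (x • a + y • b) := by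
    ext n
    simp [stack, Matrix.mulVec, dotProduct, Fin.sum_univ_two, mul_comm]
  have hquad (x y : ℂ) : star ![x, y] ⬝ᵥ (((stack a b)ᴴ * stack a b) *ᵥ ![x, y]) =
      ((‖x • a + y • b‖ ^ 2 : ℝ) : ℂ) := by
    rw [← Matrix.mulVec_mulVec, Matrix.dotProduct_mulVec, Matrix.vecMul_conjTranspose, star_star,
      hcomb, EuclideanSpace.norm_sq_eq]
    simp [dotProduct, ← Complex.conj_mul']
  have hnorm (x y : ℂ) : star ![x, y] ⬝ᵥ ![x, y] = ((‖x‖ ^ 2 + ‖y‖ ^ 2 : ℝ) : ℂ) := by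
    simp [dotProduct, Fin.sum_univ_two, ← Complex.conj_mul']
  have hle (x y : ℂ) : (m : ℂ) * (star ![x, y] ⬝ᵥ ![x, y]) ≤
        star ![x, y] ⬝ᵥ (((stack a b)ᴴ * stack a b) *ᵥ ![x, y]) ↔
      m * (‖x‖ ^ 2 + ‖y‖ ^ 2) ≤ ‖x • a + y • b‖ ^ 2 := by
    rw [hnorm, hquad, ← Complex.ofReal_mul, Complex.real_le_real]
  rw [gramMin, le_iInf_eigenvalues_iff]
  refine ⟨fun h x y => (hle x y).1 (h _), fun h v => ?_⟩
  rw [← FinVec.etaExpand_eq v]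
  exact (hle _ _).2 (h _ _)

section

variable {N : ℕ} {D D' : ℝ → Set (V N)} {c : ℝ}

lemma NormCriterion.eventually_le (h : NormCriterion D c) {δ : ℝ} (hδ : 0 < δ) :
    ∀ᶠ ρ in atTop, ∀ a ∈ D ρ, ρ ^ (c - δ) ≤ ‖a‖ ^ 2 := by
  obtain ⟨ε, hε, h⟩ := h
  filter_upwards [h δ hδ, eventually_ge_atTop 1] with ρ h hρ a ha
  exact (Real.rpow_le_rpow_of_exponent_le hρ (by linarith)).trans (h _ ⟨a, ha, rfl⟩)

lemma GramCriterion.eventually_le (h : GramCriterion D D' c) {δ : ℝ} (hδ : 0 < δ) :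
    ∀ᶠ ρ in atTop, ∀ a ∈ D ρ, ∀ b ∈ D' ρ, ∀ x y : ℂ,
      ρ ^ (c - δ) * (‖x‖ ^ 2 + ‖y‖ ^ 2) ≤ ‖x • a + y • b‖ ^ 2 := by
  obtain ⟨ε, hε, h⟩ := h
  filter_upwards [h δ hδ, eventually_ge_atTop 1] with ρ h hρ a ha b hb
  exact le_gramMin_stack_iff.1
    ((Real.rpow_le_rpow_of_exponent_le hρ (by linarith)).trans (h _ ⟨a, ha, b, hb, rfl⟩))

lemma gramMin_stack_comm (a b : V N) : gramMin (stack a b) = gramMin (stack b a) :=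
  eq_of_forall_le_iff fun m => by
    simp only [le_gramMin_stack_iff]
    rw [forall_comm]
    simp only [add_comm]

lemma GramCriterion.symm (h : GramCriterion D D' c) : GramCriterion D' D c := by
  obtain ⟨ε, hε, h⟩ := h
  refine ⟨ε, hε, fun δ hδ => ?_⟩
  filter_upwards [h δ hδ] with ρ h
  rintro _ ⟨b, hb, a, ha, rfl⟩
  exact h _ ⟨a, ha, b, hb, gramMin_stack_comm b a⟩

end

/-! ### The exponents as functions of the separation of codeword differences -/

/-- Exponent of an error in own messages only. The own signal has power exponent `c`, its
codeword differences have squared norm `≥̇ ρ ^ e`, and the undecoded interfering message has power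
exponent `p`. -/
noncomputable def singleExponent (α c e p : ℝ) : ℝ := max (c + e - max (α - 1 + p) 0) 0

/-- Exponent of a joint error in own messages and the interfering public message. The own signal has
power exponent `c`, the pairs of codeword differences have least Gram eigenvalue `≥̇ ρ ^ e`, and the
undecoded interfering message has power exponent `p`. -/
noncomputable def jointExponent (α c e p : ℝ) : ℝ :=
  if p < 1 + e then max (c + e) 0 + max (α + e) 0 else singleExponent α c e p

section

variable (α c e p : ℝ)

lemma singleExponent_eq : singleExponent α c e p =
    if p < 1 - α then max (c + e) 0 else max (1 - α - p + c + e) 0 := by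
  rw [singleExponent]
  split_ifs with h
  · rw [max_eq_right (a := α - 1 + p) (by linarith), sub_zero]
  · rw [max_eq_left (a := α - 1 + p) (by linarith)]
    ring_nf

variable (i : Fin 2) (r s pw : Fin 2 → ℝ)

lemma d1_eq : d1 α i r s pw = singleExponent α (pw i) (-s i) (pw (other i)) := by
  rw [d1, singleExponent_eq]
  ring_nf

lemma d2_eq : d2 α i r s pw = singleExponent α 1 (-r i + s i) (pw (other i)) := by
  rw [d2, singleExponent_eq]
  ring_nf

lemma d3_eq : d3 α i r s pw = singleExponent α 1 (-r i) (pw (other i)) := by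
  rw [d3, singleExponent_eq]
  ring_nf

lemma d4_eq : d4 α i r s pw =
    jointExponent α (pw i) (-s i - r (other i) + s (other i)) (pw (other i)) := by
  rw [d4, jointExponent, singleExponent_eq]
  ring_nf

lemma d5_eq : d5 α i r s pw =
    jointExponent α 1 (-(∑ k, r k) + ∑ k, s k) (pw (other i)) := by
  rw [d5, jointExponent, singleExponent_eq]
  ring_nf

lemma d6_eq : d6 α i r s pw =
    jointExponent α 1 (-r i - r (other i) + s (other i)) (pw (other i)) := by
  rw [d6, jointExponent, singleExponent_eq]
  ring_nf

end

/-! ### Channel outage -/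

lemma hasOutageExponent_joint_fade (α c e p : ℝ) :
    HasOutageExponent (cn.prod cn)
      (fun δ ρ => {h | ρ ^ (c + e - δ) * ‖h.1‖ ^ 2 + ρ ^ (α + e - δ) * ‖h.2‖ ^ 2 ≤
        ρ ^ δ * (1 + ρ ^ (α - 1 + p) * ‖h.2‖ ^ 2)})
      (jointExponent α c e p) := by
  rw [jointExponent]
  split_ifs with hp
  · exact hasOutageExponent_double_fade (c + e) (by linarith)
  · refine (hasOutageExponent_direct_fade (c + e) (α - 1 + p)).mono (.of_forall fun δ => ?_)
    filter_upwards [eventually_ge_atTop 0] with ρ hρ h hh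
    have hcross : 0 ≤ ρ ^ (α + e - δ) * ‖h.2‖ ^ 2 := by positivity
    exact (le_add_of_nonneg_right hcross).trans hh

/-- The channels for which some difference `a ∈ D ρ` of own codewords, received with power exponent
`c`, is too weak, alone or together with a difference `b ∈ D' ρ` of interfering public codewords,
to stand out from noise and the interference of the undecoded message of power exponent `p`. The
choice `b = 0` encodes an error in own messages only. -/
def channelOutage {N : ℕ} (D D' : ℝ → Set (V N)) (α c p δ ρ : ℝ) : Set (ℂ × ℂ) :=
  {h | ∃ a ∈ D ρ, ∃ b ∈ insert 0 (D' ρ),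
    ‖((√(ρ ^ c) : ℂ) * h.1) • a + ((√(ρ ^ α) : ℂ) * h.2) • b‖ ^ 2 ≤
      ρ ^ δ * (1 + ρ ^ (α - 1 + p) * ‖h.2‖ ^ 2)}

lemma norm_sqrt_rpow_mul_sq {ρ : ℝ} (hρ : 0 ≤ ρ) (c : ℝ) (h : ℂ) :
    ‖(√(ρ ^ c) : ℂ) * h‖ ^ 2 = ρ ^ c * ‖h‖ ^ 2 := by
  rw [norm_mul, mul_pow, Complex.norm_real, Real.norm_of_nonneg (Real.sqrt_nonneg _),
    Real.sq_sqrt (by positivity)]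

lemma hasOutageExponent_channelOutage {N : ℕ} {D D' : ℝ → Set (V N)} {e e' : ℝ}
    (hD : NormCriterion D e) (hDD' : GramCriterion D D' e') (α c p : ℝ) :
    HasOutageExponent (cn.prod cn) (channelOutage D D' α c p)
      (min (singleExponent α c e p) (jointExponent α c e' p)) := by
  refine (((hasOutageExponent_direct_fade (c + e) (α - 1 + p)).of_le (min_le_left _ _)).union
    ((hasOutageExponent_joint_fade α c e' p).of_le (min_le_right _ _))).mono ?_
  filter_upwards [self_mem_nhdsWithin] with δ hδ
  filter_upwards [hD.eventually_le hδ, hDD'.eventually_le hδ, eventually_gt_atTop 0]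
    with ρ hD hDD' hρ
  have hrpow (x y z : ℝ) : ρ ^ (x + y - δ) * z = ρ ^ (y - δ) * (ρ ^ x * z) := by
    rw [add_sub_assoc, Real.rpow_add hρ]
    ring
  rintro h ⟨a, ha, b, rfl | hb, hle⟩
  · refine Or.inl (le_trans ?_ hle)
    rw [smul_zero, add_zero, norm_smul, mul_pow, norm_sqrt_rpow_mul_sq hρ.le, hrpow, mul_comm]
    gcongr
    exact hD a ha
  · refine Or.inr (le_trans ?_ hle)
    rw [hrpow, hrpow, ← mul_add, ← norm_sqrt_rpow_mul_sq hρ.le, ← norm_sqrt_rpow_mul_sq hρ.le]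
    exact hDD' a ha b hb _ _

/-- The channel outages of receiver `i`, for errors in its private message, in its public message,
or in both. -/
def receiverOutage {N : ℕ} (α : ℝ) (i : Fin 2) (p : Fin 2 → ℝ) (Cu Cw : Fin 2 → ℝ → Finset (V N))
    (δ ρ : ℝ) : Set (ℂ × ℂ) :=
  channelOutage (privateDiffs (p i) (Cu i)) (diffs (Cw (other i))) α (p i) (p (other i)) δ ρ ∪
  channelOutage (diffs (Cw i)) (diffs (Cw (other i))) α 1 (p (other i)) δ ρ ∪
  channelOutage (combinedDiffs (Cu i) (Cw i)) (diffs (Cw (other i))) α 1 (p (other i)) δ ρ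

lemma SuperpositionCriteria.hasOutageExponent_receiverOutage {N : ℕ} {α d : ℝ} {p : Fin 2 → ℝ}
    {Υ Ψ : Fin 2 → Fin 6 → Fin 2 → ℝ} {Cu Cw : Fin 2 → ℝ → Finset (V N)}
    (h : SuperpositionCriteria p Υ Ψ Cu Cw) (i : Fin 2)
    (hd : ∀ m, d ≤ dkl α i m (Υ i m) (Ψ i m) p) :
    HasOutageExponent (cn.prod cn) (receiverOutage α i p Cu Cw) d := by
  have hpriv := hasOutageExponent_channelOutage (h.priv i) (h.privPub i) α (p i) (p (other i))
  have hpub := hasOutageExponent_channelOutage (h.pub i) (h.pubPub i) α 1 (p (other i))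
  have hcombined :=
    hasOutageExponent_channelOutage (h.combined i) (h.combinedPub i) α 1 (p (other i))
  rw [← d1_eq α i (Υ i 0), ← d4_eq] at hpriv
  rw [← d2_eq, ← d5_eq] at hpub
  rw [← d3_eq α i (Υ i 2) (Ψ i 2), ← d6_eq] at hcombined
  exact ((hpriv.of_le (le_min (hd 0) (hd 3))).union (hpub.of_le (le_min (hd 1) (hd 4)))).union
    (hcombined.of_le (le_min (hd 2) (hd 5)))

/-! ### Decoding errors -/

lemma exists_le_add_log_card {ι : Type*} {s : Finset ι} (hs : s.Nonempty) {f : ι → ℝ} {a : ℝ}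
    (h : Real.exp (-a) ≤ ∑ i ∈ s, Real.exp (-f i)) : ∃ i ∈ s, f i ≤ a + Real.log s.card := by
  have hcard : (0 : ℝ) < s.card := by exact_mod_cast hs.card_pos
  have hmean : ∑ _ ∈ s, Real.exp (-(a + Real.log s.card)) ≤ ∑ i ∈ s, Real.exp (-f i) := by
    refine le_of_eq_of_le ?_ h
    rw [Finset.sum_const, nsmul_eq_mul, neg_add, Real.exp_add, Real.exp_neg (Real.log _),
      Real.exp_log hcard]
    field_simp
  obtain ⟨i, hi, hle⟩ := Finset.exists_le_of_sum_le hs hmean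
  exact ⟨i, hi, neg_le_neg_iff.1 (Real.exp_le_exp.1 hle)⟩

lemma exists_norm_sq_le_of_likelihood_le {N : ℕ} {α ρ : ℝ} {Cuj : Finset (V N)} {h : ℂ × ℂ}
    {z u w v u' u₁ w₁ v₁ : V N} (hu' : u' ∈ Cuj)
    (hL : likelihood α ρ Cuj h (signal α ρ h (u + w) (u' + v) + z) u w v ≤
      likelihood α ρ Cuj h (signal α ρ h (u + w) (u' + v) + z) u₁ w₁ v₁) :
    ∃ u'' ∈ Cuj, ‖signal α ρ h (u + w) (u' + v) + z - signal α ρ h (u₁ + w₁) (u'' + v₁)‖ ^ 2 ≤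
      ‖z‖ ^ 2 + Real.log Cuj.card := by
  refine exists_le_add_log_card ⟨u', hu'⟩ (le_trans ?_ hL)
  calc Real.exp (-‖z‖ ^ 2)
      = Real.exp (-‖signal α ρ h (u + w) (u' + v) + z - signal α ρ h (u + w) (u' + v)‖ ^ 2) := by
        rw [add_sub_cancel_left]
    _ ≤ likelihood α ρ Cuj h (signal α ρ h (u + w) (u' + v) + z) u w v :=
        Finset.single_le_sum (f := fun x =>
          Real.exp (-‖signal α ρ h (u + w) (u' + v) + z - signal α ρ h (u + w) (x + v)‖ ^ 2))
          (fun _ _ => (Real.exp_pos _).le) hu'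

lemma norm_sub_sub_sq_le {E : Type*} [SeminormedAddCommGroup E] (a b c : E) :
    ‖a - b - c‖ ^ 2 ≤ 3 * (‖a‖ ^ 2 + ‖b‖ ^ 2 + ‖c‖ ^ 2) := by
  have htriangle : ‖a - b - c‖ ≤ ‖a‖ + ‖b‖ + ‖c‖ :=
    (norm_sub_le _ _).trans (by gcongr; exact norm_sub_le _ _)
  calc ‖a - b - c‖ ^ 2 ≤ (‖a‖ + ‖b‖ + ‖c‖) ^ 2 := by gcongr
    _ ≤ 3 * (‖a‖ ^ 2 + ‖b‖ ^ 2 + ‖c‖ ^ 2) := by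
      linarith [sq_nonneg (‖a‖ - ‖b‖), sq_nonneg (‖a‖ - ‖c‖), sq_nonneg (‖b‖ - ‖c‖)]

lemma norm_interference_sq_le {N : ℕ} {α ρ p : ℝ} (hρ : 0 < ρ) (g : ℂ) {u u' : V N}
    (hu : ‖u‖ ≤ √(N / ρ ^ (1 - p))) (hu' : ‖u'‖ ≤ √(N / ρ ^ (1 - p))) :
    ‖((√(ρ ^ α) : ℂ) * g) • (u - u')‖ ^ 2 ≤ 4 * N * (ρ ^ (α - 1 + p) * ‖g‖ ^ 2) := by
  have hdiff : ‖u - u'‖ ≤ 2 * √(N / ρ ^ (1 - p)) := by linarith [norm_sub_le u u']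
  calc ‖((√(ρ ^ α) : ℂ) * g) • (u - u')‖ ^ 2 = ρ ^ α * ‖g‖ ^ 2 * ‖u - u'‖ ^ 2 := by
        rw [norm_smul, mul_pow, norm_sqrt_rpow_mul_sq hρ.le]
    _ ≤ ρ ^ α * ‖g‖ ^ 2 * (2 * √(N / ρ ^ (1 - p))) ^ 2 := by gcongr
    _ = 4 * N * (ρ ^ (α - 1 + p) * ‖g‖ ^ 2) := by
        rw [mul_pow, Real.sq_sqrt (by positivity), show α - 1 + p = α - (1 - p) by ring,
          Real.rpow_sub hρ α]
        ring

lemma norm_signal_sq_le {N : ℕ} {α ρ p M : ℝ} (hρ : 0 < ρ) (hM : 1 ≤ M) {Cuj : Finset (V N)}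
    (hpow : ∀ u ∈ Cuj, ‖u‖ ≤ √(N / ρ ^ (1 - p))) (hlog : Real.log Cuj.card ≤ M)
    {h : ℂ × ℂ} {z u w v u' u₁ w₁ v₁ : V N} (hu' : u' ∈ Cuj) (hz : ‖z‖ ^ 2 ≤ N * M)
    (hL : likelihood α ρ Cuj h (signal α ρ h (u + w) (u' + v) + z) u w v ≤
      likelihood α ρ Cuj h (signal α ρ h (u + w) (u' + v) + z) u₁ w₁ v₁) :
    ‖signal α ρ h (u + w - (u₁ + w₁)) (v - v₁)‖ ^ 2 ≤
      12 * (N + 1) * M * (1 + ρ ^ (α - 1 + p) * ‖h.2‖ ^ 2) := by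
  obtain ⟨u'', hu'', hresidual⟩ := exists_norm_sq_le_of_likelihood_le hu' hL
  have hinterference := norm_interference_sq_le (α := α) hρ h.2 (hpow u' hu') (hpow u'' hu'')
  set X := ρ ^ (α - 1 + p) * ‖h.2‖ ^ 2
  have hX : 0 ≤ X := by positivity
  have hNX : N * X ≤ N * (M * X) := by gcongr; exact le_mul_of_one_le_left hX hM
  have hMX : 0 ≤ M * X := by positivity
  calc ‖signal α ρ h (u + w - (u₁ + w₁)) (v - v₁)‖ ^ 2
      = ‖signal α ρ h (u + w) (u' + v) + z - signal α ρ h (u₁ + w₁) (u'' + v₁) -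
          ((√(ρ ^ α) : ℂ) * h.2) • (u' - u'') - z‖ ^ 2 := by
        congr 2
        simp only [signal]
        module
    _ ≤ 3 * (‖z‖ ^ 2 + Real.log Cuj.card + 4 * N * X + ‖z‖ ^ 2) :=
        (norm_sub_sub_sq_le _ _ _).trans (by gcongr)
    _ ≤ 3 * (N * M + M + 4 * N * (M * X) + N * M) := by linarith
    _ ≤ 12 * (N + 1) * M * (1 + X) := by
        have : 0 ≤ N * M := by positivity
        linarith

lemma mem_receiverOutage_of_norm_signal_sq_le {N : ℕ} {α ρ δ : ℝ} (hρ : 0 < ρ) {i : Fin 2}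
    {p : Fin 2 → ℝ} {Cu Cw : Fin 2 → ℝ → Finset (V N)} {h : ℂ × ℂ} {u u₁ w w₁ v v₁ : V N}
    (hu : u ∈ Cu i ρ) (hu₁ : u₁ ∈ Cu i ρ) (hw : w ∈ Cw i ρ) (hw₁ : w₁ ∈ Cw i ρ)
    (hv : v ∈ Cw (other i) ρ) (hv₁ : v₁ ∈ Cw (other i) ρ) (hne : (u₁, w₁) ≠ (u, w))
    (hle : ‖signal α ρ h (u + w - (u₁ + w₁)) (v - v₁)‖ ^ 2 ≤
      ρ ^ δ * (1 + ρ ^ (α - 1 + p (other i)) * ‖h.2‖ ^ 2)) :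
    h ∈ receiverOutage α i p Cu Cw δ ρ := by
  have hcross : v - v₁ ∈ insert 0 (diffs (Cw (other i)) ρ) := by
    obtain rfl | hvv₁ := eq_or_ne v v₁
    · exact Or.inl (sub_self v)
    · exact Or.inr ⟨v, hv, v₁, hv₁, hvv₁, rfl⟩
  obtain rfl | huu₁ := eq_or_ne u u₁ <;> obtain rfl | hww₁ := eq_or_ne w w₁
  · exact absurd rfl hne
  · refine Or.inl (Or.inr ⟨w - w₁, ⟨w, hw, w₁, hw₁, hww₁, rfl⟩, v - v₁, hcross, ?_⟩)
    simpa [signal] using hle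
  · refine Or.inl (Or.inl ⟨_, ⟨u, hu, u₁, hu₁, huu₁, rfl⟩, v - v₁, hcross, ?_⟩)
    have hsqrt : (√(ρ ^ p i) : ℂ) * √(ρ ^ (1 - p i)) = √ρ := by
      rw [← Complex.ofReal_mul, ← Real.sqrt_mul (by positivity), ← Real.rpow_add hρ]
      simp
    rw [smul_smul, mul_right_comm, hsqrt]
    simpa [signal] using hle
  · refine Or.inr ⟨u + w - (u₁ + w₁), ⟨u, hu, u₁, hu₁, w, hw, w₁, hw₁, huu₁, hww₁, rfl⟩,
      v - v₁, hcross, ?_⟩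
    simpa [signal] using hle

lemma rxErrorProb_le {N : ℕ} {α ρ B : ℝ} {Cu Cw : Fin 2 → Finset (V N)} {i : Fin 2}
    (hB : 0 ≤ B)
    (h : ∀ u ∈ Cu i, ∀ w ∈ Cw i, ∀ u' ∈ Cu (other i), ∀ v ∈ Cw (other i),
      ((cn.prod cn).prod (cnVec N)).real
        {ω | DecodingError α ρ Cu Cw i ω.1 (signal α ρ ω.1 (u + w) (u' + v) + ω.2) u w} ≤ B) :
    rxErrorProb α ρ Cu Cw i ≤ B := by
  refine inv_mul_le_of_le_mul₀ (by positivity) hB ?_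
  calc _ ≤ ∑ _ ∈ Cu i, ∑ _ ∈ Cw i, ∑ _ ∈ Cu (other i), ∑ _ ∈ Cw (other i), B :=
        Finset.sum_le_sum fun u hu => Finset.sum_le_sum fun w hw => Finset.sum_le_sum
          fun u' hu' => Finset.sum_le_sum fun v hv => h u hu w hw u' hu' v hv
    _ = _ := by
        simp only [Finset.sum_const, nsmul_eq_mul]
        ring

lemma expLE_rxErrorProb {N : ℕ} {α d : ℝ} {i : Fin 2} {p : Fin 2 → ℝ}
    {Cu Cw : Fin 2 → ℝ → Finset (V N)}
    (hpow : ∀ᶠ ρ in atTop, ∀ u ∈ Cu (other i) ρ, ‖u‖ ≤ √(N / ρ ^ (1 - p (other i))))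
    (hlog : ExpLE (fun ρ => Real.log (Cu (other i) ρ).card) 0)
    (hout : HasOutageExponent (cn.prod cn) (receiverOutage α i p Cu Cw) d) :
    ExpLE (fun ρ => rxErrorProb α ρ (fun i => Cu i ρ) (fun i => Cw i ρ) i) (-d) := by
  intro η hη
  have hbad := (hout.preimage_fst (ν := cnVec N)).union
    ((hasOutageExponent_cnVec_rpow_lt_norm_sq N d one_half_pos).preimage_snd (μ := cn.prod cn))
  obtain ⟨δ, hbad, hδ : 0 < δ⟩ := ((hbad η hη).and self_mem_nhdsWithin).exists
  filter_upwards [hbad, hpow, hlog (1 / 2 * δ) (by positivity), eventually_ge_atTop 1,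
    eventually_le_rpow (12 * (N + 1)) (show 0 < 1 / 2 * δ by positivity)]
    with ρ hbad hpow hlog hρ hconst
  have hρ0 : 0 < ρ := by linarith
  rw [zero_add] at hlog
  refine rxErrorProb_le (by positivity) fun u hu w hw u' hu' v hv =>
    (measureReal_mono ?_).trans hbad
  rintro ⟨h, z⟩ ⟨u₁, hu₁, w₁, hw₁, v₁, hv₁, hne, hL⟩
  refine or_iff_not_imp_right.2 fun hz => ?_
  have hsignal := norm_signal_sq_le hρ0 (Real.one_le_rpow hρ (by positivity)) hpow hlog hu'
    (not_lt.1 hz) (hL v hv)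
  refine mem_receiverOutage_of_norm_signal_sq_le hρ0 hu hu₁ hw hw₁ hv hv₁ hne (hsignal.trans ?_)
  calc 12 * (N + 1) * ρ ^ (1 / 2 * δ) * (1 + ρ ^ (α - 1 + p (other i)) * ‖h.2‖ ^ 2)
      ≤ ρ ^ (1 / 2 * δ) * ρ ^ (1 / 2 * δ) * (1 + ρ ^ (α - 1 + p (other i)) * ‖h.2‖ ^ 2) := by
        gcongr
    _ = ρ ^ δ * (1 + ρ ^ (α - 1 + p (other i)) * ‖h.2‖ ^ 2) := by
        rw [← Real.rpow_add hρ0]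
        ring_nf

/-! ### Achievability -/

lemma IsCodebookSeq.expLE_log_card {N : ℕ} {r : ℝ} {C : ℝ → Finset (V N)}
    (hC : IsCodebookSeq r C) : ExpLE (fun ρ => Real.log (C ρ).card) 0 := by
  intro δ hδ
  rw [zero_add]
  have hsubpoly := ((isLittleO_log_rpow_atTop hδ).const_mul_left (N * r + 1)).bound one_pos
  filter_upwards [hC.rate.eventually_lt_const (lt_add_one _), hsubpoly, eventually_gt_atTop 1]
    with ρ hrate hsubpoly hρ
  rw [div_lt_iff₀ (Real.log_pos hρ)] at hrate
  rw [one_mul, Real.norm_of_nonneg (Real.rpow_nonneg (by linarith) δ)] at hsubpoly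
  exact hrate.le.trans ((Real.le_norm_self _).trans hsubpoly)

lemma ExpLE.errorProb {N : ℕ} {α c : ℝ} {Cu Cw : Fin 2 → ℝ → Finset (V N)}
    (h : ∀ i, ExpLE (fun ρ => rxErrorProb α ρ (fun i => Cu i ρ) (fun i => Cw i ρ) i) c) :
    ExpLE (fun ρ => errorProb α ρ (fun i => Cu i ρ) (fun i => Cw i ρ)) c := by
  intro δ hδ
  filter_upwards [h 0 δ hδ, h 1 δ hδ] with ρ h0 h1
  exact max_le h0 h1

lemma expLE_errorProb_superposition {N : ℕ} {α d : ℝ} {p : Fin 2 → ℝ}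
    {Υ Ψ : Fin 2 → Fin 6 → Fin 2 → ℝ} {Cu Cw : Fin 2 → ℝ → Finset (V N)}
    (hd : ∀ n m, d ≤ dkl α n m (Υ n m) (Ψ n m) p)
    (hlog : ∀ i, ExpLE (fun ρ => Real.log (Cu i ρ).card) 0)
    (hpow : ∀ i, ∀ᶠ ρ in atTop, ∀ u ∈ Cu i ρ, ‖u‖ ≤ √(N / ρ ^ (1 - p i)))
    (hcrit : SuperpositionCriteria p Υ Ψ Cu Cw) :
    ExpLE (fun ρ => errorProb α ρ (fun i => Cu i ρ) (fun i => Cw i ρ)) (-d) :=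
  .errorProb fun i => expLE_rxErrorProb (hpow (other i)) (hlog (other i))
    (hcrit.hasOutageExponent_receiverOutage i (hd i))

lemma receiverOutage_public {N : ℕ} (α : ℝ) (i : Fin 2) (p : Fin 2 → ℝ)
    (C : Fin 2 → ℝ → Finset (V N)) :
    receiverOutage α i p (fun _ _ => {0}) C =
      channelOutage (diffs (C i)) (diffs (C (other i))) α 1 (p (other i)) := by
  ext
  simp [receiverOutage, channelOutage, privateDiffs, combinedDiffs]

lemma expLE_rxErrorProb_public {N : ℕ} {α d e e' : ℝ} {i : Fin 2} {C : Fin 2 → ℝ → Finset (V N)}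
    (hnorm : NormCriterion (diffs (C i)) e)
    (hgram : GramCriterion (diffs (C i)) (diffs (C (other i))) e')
    (hd : d ≤ max (1 + e) 0) (hd' : d ≤ max (1 + e') 0 + max (α + e') 0) :
    ExpLE (fun ρ => rxErrorProb α ρ (fun _ => {0}) (fun i => C i ρ) i) (-d) := by
  -- The zero private codebook meets the power constraint for every exponent. This one puts its
  -- interference below the noise and makes a joint error require a double fade.
  let p : ℝ := min (1 - α) e'
  have hsingle : d ≤ singleExponent α 1 e p := by
    rwa [singleExponent, max_eq_right (a := α - 1 + p) (by linarith [min_le_left (1 - α) e']),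
      sub_zero]
  have hjoint : d ≤ jointExponent α 1 e' p := by
    rwa [jointExponent, if_pos (by linarith [min_le_right (1 - α) e'])]
  refine expLE_rxErrorProb (p := fun _ => p) (Cu := fun _ _ => {0}) ?_ ?_ ?_
  · refine .of_forall fun ρ u hu => ?_
    rw [Finset.mem_singleton.1 hu, norm_zero]
    positivity
  · intro δ _
    filter_upwards [eventually_ge_atTop 0] with ρ hρ
    simpa using Real.rpow_nonneg hρ δ
  · rw [receiverOutage_public]
    exact (hasOutageExponent_channelOutage hnorm hgram α 1 p).of_le (le_min hsingle hjoint)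

lemma expLE_errorProb_public {N : ℕ} {α d : ℝ} {Γ : Fin 3 → Fin 2 → ℝ}
    {C : Fin 2 → ℝ → Finset (V N)} (hd : ∀ i, d ≤ dMUi α i (Γ i)) (hcrit : MACCriteria Γ C) :
    ExpLE (fun ρ => errorProb α ρ (fun _ => {0}) (fun i => C i ρ)) (-d) := by
  have hjoint : d ≤ max (1 + (-Γ 2 0 - Γ 2 1)) 0 + max (α + (-Γ 2 0 - Γ 2 1)) 0 := by
    refine (hd 2).trans_eq ?_
    simp only [dMUi, Matrix.cons_val]
    ring_nf
  refine .errorProb (Cu := fun _ _ => {0}) fun i => ?_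
  fin_cases i
  · exact expLE_rxErrorProb_public hcrit.user1 hcrit.joint (hd 0) hjoint
  · exact expLE_rxErrorProb_public hcrit.user2 hcrit.joint.symm (hd 1) hjoint

lemma dmt_eq_dMUi {α : ℝ} {r : Fin 2 → ℝ} (h : dHK α r ≤ dMU α r) {j : Fin 3}
    (hj : ∀ i, dMUi α j r ≤ dMUi α i r) : dmt α r = dMUi α j r := by
  rw [dmt, max_eq_right h]
  exact le_antisymm (ciInf_le (Set.finite_range _).bddBelow j) (le_ciInf hj)

lemma dSplit_le_dkl (α : ℝ) (r s p : Fin 2 → ℝ) (k : Fin 2) (l : Fin 6) :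
    dSplit α r s p ≤ dkl α k l r s p :=
  ciInf_le (f := fun kl : Fin 2 × Fin 6 => dkl α kl.1 kl.2 r s p) (Set.finite_range _).bddBelow
    (k, l)

lemma IsOptimalSplit.dmt_eq_dSplit {α : ℝ} {r s t p : Fin 2 → ℝ} (hopt : IsOptimalSplit α r s t p)
    (h : dMU α r ≤ dHK α r) : dmt α r = dSplit α r s p := by
  have hgreatest : IsGreatest {d | ∃ s t p, Feasible r s t p ∧ d = dSplit α r s p}
      (dSplit α r s p) :=
    ⟨⟨s, t, p, hopt.1, rfl⟩, by rintro _ ⟨s', t', p', hf, rfl⟩; exact hopt.2 s' t' p' hf⟩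
  rw [dmt, max_eq_left h, dHK, hgreatest.csSup_eq]

end FadingIC

theorem theorem3_general {N : ℕ} {α d : ℝ} :
    (∀ (Γ : Fin 3 → Fin 2 → ℝ) (C : Fin 2 → ℝ → Finset (FadingIC.V N)),
      (∀ i, d ≤ FadingIC.dMUi α i (Γ i)) →
      FadingIC.MACCriteria Γ C →
      FadingIC.ExpLE (fun ρ => FadingIC.errorProb α ρ (fun _ => {0}) (fun i => C i ρ)) (-d)) ∧
    (∀ (p : Fin 2 → ℝ) (Υ Ψ : Fin 2 → Fin 6 → Fin 2 → ℝ)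
      (Cu Cw : Fin 2 → ℝ → Finset (FadingIC.V N)),
      (∀ n m, d ≤ FadingIC.dkl α n m (Υ n m) (Ψ n m) p) →
      (∀ i, FadingIC.ExpLE (fun ρ => Real.log (Cu i ρ).card) 0) →
      (∀ i, ∀ᶠ ρ in atTop, ∀ u ∈ Cu i ρ, ‖u‖ ≤ √(N / ρ ^ (1 - p i))) →
      FadingIC.SuperpositionCriteria p Υ Ψ Cu Cw →
      FadingIC.ExpLE (fun ρ => FadingIC.errorProb α ρ (fun i => Cu i ρ) (fun i => Cw i ρ))
        (-d)) :=
  ⟨fun _ _ => FadingIC.expLE_errorProb_public,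
    fun _ _ _ _ _ => FadingIC.expLE_errorProb_superposition⟩

theorem theorem3 (N : ℕ) (hN : 2 ≤ N) (α : ℝ) (hα : 0 ≤ α)
    (r : Fin 2 → ℝ) (hr : ∀ i, 0 ≤ r i ∧ r i ≤ 1) :
    -- public messages only
    (FadingIC.dHK α r ≤ FadingIC.dMU α r →
      ∀ (jstar : Fin 3), (∀ i, FadingIC.dMUi α jstar r ≤ FadingIC.dMUi α i r) →
      ∀ (Γ : Fin 3 → Fin 2 → ℝ), (∀ i, FadingIC.dMUi α i (Γ i) = FadingIC.dMUi α jstar r) →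
      ∀ (C : Fin 2 → ℝ → Finset (FadingIC.V N)),
        (∀ i, FadingIC.IsCodebookSeq (r i) (C i)) →
        (∀ i, ∀ ρ : ℝ, 1 < ρ → ∀ x ∈ C i ρ, ‖x‖ ^ 2 ≤ N) →
        FadingIC.MACCriteria Γ C →
        FadingIC.ExpLE (fun ρ => FadingIC.errorProb α ρ (fun _ => {0}) (fun i => C i ρ))
          (-FadingIC.dmt α r)) ∧
    -- superposition of private and public messages
    (FadingIC.dMU α r < FadingIC.dHK α r →
      ∀ (s t p : Fin 2 → ℝ), FadingIC.Feasible r s t p →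
      ∀ (kstar : Fin 2) (lstar : Fin 6),
        (∀ n m, FadingIC.dkl α kstar lstar r s p ≤ FadingIC.dkl α n m r s p) →
      ∀ (Υ Ψ : Fin 2 → Fin 6 → Fin 2 → ℝ),
        (∀ n m, FadingIC.dkl α kstar lstar r s p ≤ FadingIC.dkl α n m (Υ n m) (Ψ n m) p) →
      ∀ (Cu Cw : Fin 2 → ℝ → Finset (FadingIC.V N)),
        (∀ i, FadingIC.IsCodebookSeq (s i) (Cu i)) →
        (∀ i, FadingIC.IsCodebookSeq (t i) (Cw i)) →
        FadingIC.PowerSplit p Cu Cw →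
        FadingIC.SuperpositionCriteria p Υ Ψ Cu Cw →
        FadingIC.ExpLE (fun ρ => FadingIC.errorProb α ρ (fun i => Cu i ρ) (fun i => Cw i ρ))
          (-FadingIC.dSplit α r s p) ∧
        (FadingIC.IsOptimalSplit α r s t p →
          FadingIC.ExpLE (fun ρ => FadingIC.errorProb α ρ (fun i => Cu i ρ) (fun i => Cw i ρ))
            (-FadingIC.dmt α r))) := by
  refine ⟨fun hle j hj Γ hΓ C _ _ hcrit => ?_, fun hlt s t p _ k l _ Υ Ψ hd Cu Cw hCu _ hP hcrit =>
    ?_⟩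
  · rw [FadingIC.dmt_eq_dMUi hle hj]
    exact theorem3_general.1 Γ C (fun i => (hΓ i).ge) hcrit
  · have hsplit := theorem3_general.2 p Υ Ψ Cu Cw
      (fun n m => (FadingIC.dSplit_le_dkl α r s p k l).trans (hd n m))
      (fun i => (hCu i).expLE_log_card)
      (fun i => (eventually_gt_atTop 1).mono fun ρ hρ => (hP i ρ hρ).1) hcrit
    exact ⟨hsplit, fun hopt => by rwa [hopt.dmt_eq_dSplit hlt.le]⟩
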